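/- Let $n\in\mathbb N$, $T>0$, let $A:[0,T]\to\mathbb C^{n\times n}$ be continuous and $u_0\in\mathbb C^n$. Write $A=H_1+iH_2$ with the Hermitian matrices $H_1=(A+A^\dagger)/2$ and $H_2=(A-A^\dagger)/(2i)$, and put $$\lambda^+_{\max}(H_1)=\max\Big\{\sup_{0<t<T}\{|\lambda| : \lambda \text{ an eigenvalue of } H_1(t),\ \lambda>0\},\,0\Big\}$$ (with $\sup\emptyset=0$); no sign condition on the eigenvalues of $H_1$ is assumed. Consider the Schrödingerized transport system $$\partial_t w=-H_1(t)\,\partial_p w+iH_2(t)\,w,\qquad w(0,p)=e^{-|p|}u_0,\qquad t\in[0,T],\ p\in\mathbb R. \tag{1}$$ A solution of (1) is a continuous function $w:[0,T]\times\mathbb R\to\mathbb C^n$ with $w(0,p)=e^{-|p|}u_0$ for all $p$, such that for every $\varphi\in C_c^\infty(\mathbb R)$ and every $t\in[0,T]$ (with one-sided derivatives at the end points) $$\frac{d}{dt}\int_{\mathbb R} \varphi(p)\,w(t,p)\,dp=H_1(t)\int_{\mathbb R} \varphi'(p)\,w(t,p)\,dp+iH_2(t)\int_{\mathbb R}\varphi(p)\,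 w(t,p)\,dp .$$ Then (1) has exactly one solution $w$. Moreover, if $u$ is the solution of $u'(t)=A(t)u(t)$ on $[0,T]$ with $u(0)=u_0$, and $p^\Diamond\ge\lambda^+_{\max}(H_1)\,T$, then for all $t\in[0,T]$ and all $p\ge p^\Diamond$ $$u(t)=e^{p}\,w(t,p),$$ and $w(t,\cdot)$ is integrable on $(p,\infty)$ with $$u(t)=e^{p}\int_p^\infty w(t,q)\,dq .$$ -/

import Mathlib

open Set MeasureTheory
open scoped Matrix ContDiff

noncomputable section

/-- Hermitian part `H₁ = (M + M†)/2` of a complex square matrix. -/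
def hermPart {n : ℕ} (M : Matrix (Fin n) (Fin n) ℂ) : Matrix (Fin n) (Fin n) ℂ :=
  (1 / 2 : ℂ) • (M + Mᴴ)

/-- `H₂ = (M - M†)/(2i)`, so that `M = H₁ + i H₂` with `H₁`, `H₂` Hermitian. -/
def skewPart {n : ℕ} (M : Matrix (Fin n) (Fin n) ℂ) : Matrix (Fin n) (Fin n) ℂ :=
  (1 / (2 * Complex.I)) • (M - Mᴴ)

/-- `max { sup_{0<t<T} { |l| : l an eigenvalue of H(t), l > 0 }, 0 }`
(the supremum of the empty set is `0`). -/
def lambdaMaxPlus {n : ℕ} (T : ℝ) (H : ℝ → Matrix (Fin n) (Fin n) ℂ) : ℝ :=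
  max (sSup {x : ℝ | ∃ t ∈ Ioo 0 T, ∃ l : ℝ,
    Module.End.HasEigenvalue (Matrix.toLin' (H t)) (l : ℂ) ∧ 0 < l ∧ x = |l|}) 0

/-- `u` solves `u' = A(t) u` on `[0, T]` with `u(0) = u₀` (one-sided derivatives at the ends). -/
structure IsODESolution {n : ℕ} (T : ℝ) (A : ℝ → Matrix (Fin n) (Fin n) ℂ)
    (u₀ : Fin n → ℂ) (u : ℝ → Fin n → ℂ) : Prop where
  initial : u 0 = u₀
  ode : ∀ t ∈ Icc 0 T, HasDerivWithinAt u (A t *ᵥ u t) (Icc 0 T) t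

/-- `w` is a continuous weak solution on `[0, T] × ℝ` of
`∂ₜ w = - H₁(t) ∂ₚ w + i H₂(t) w`, `w(0, p) = e^{-|p|} u₀`, where `A = H₁ + i H₂`.
The initial datum is not differentiable at `p = 0`, so `∂ₚ` is taken in the sense of
distributions: it is moved onto smooth compactly supported test functions of `p`. -/
structure IsTransportSolution {n : ℕ} (T : ℝ) (A : ℝ → Matrix (Fin n) (Fin n) ℂ)
    (u₀ : Fin n → ℂ) (w : ℝ → ℝ → Fin n → ℂ) : Prop where
  continuousOn : ContinuousOn (Function.uncurry w) (Icc 0 T ×ˢ univ)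
  initial : ∀ p : ℝ, w 0 p = Real.exp (-|p|) • u₀
  weak : ∀ φ : ℝ → ℝ, ContDiff ℝ ∞ φ → HasCompactSupport φ → ∀ t ∈ Icc 0 T,
    HasDerivWithinAt (fun s : ℝ => ∫ p, φ p • w s p)
      (hermPart (A t) *ᵥ (∫ p, deriv φ p • w t p)
        + Complex.I • (skewPart (A t) *ᵥ (∫ p, φ p • w t p)))
      (Icc 0 T) t

end

/-!
The transport system is symmetric hyperbolic with coefficients independent of `p`, so its Fourier
modes in `p` evolve unitarily and its zeros propagate with finite speed.

*Domain of dependence.* Let `w` be a continuous weak solution that vanishes on `(a, ∞)` at time `0`,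
and let `λ ≥ 0` bound the quadratic forms of `H₁`. Then `w(t, ·)` vanishes on `(a + λt, ∞)`. The
convolution of `w` with a test function in `p` is a classical solution, and for that one an energy
with a weight supported in `a + λt ≤ p ≤ R - Ct` is nonincreasing
(`eq_zero_of_symmetric_hyperbolic`, `IsWeakTransport.eq_zero_of_initial_eq_zero`). As no growth in
`p` is assumed, the right end of the weight has to move inwards too, at a speed `C ≥ ‖H₁‖`.

*Uniqueness* is this applied to the difference of two solutions, with `a` arbitrarily negative.

*Recovery.* The function `e^{-p} u(t)` also solves the system weakly
(`IsODESolution.isWeakTransport`), and its initial datum agrees with `e^{-|p|} u₀` for `p > 0`.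
The domain of dependence with `a = 0` and `λ = lambdaMaxPlus` gives `w(t, p) = e^{-p} u(t)` for
`p ≥ λt` (`IsTransportSolution.eq_exp_smul`), and both recovery formulas follow.

*Existence.* Let `V(t, ξ)` solve `∂ₜV = i (H₂ - 2πξ H₁) V` with `V(0, ξ) = u₀`, by the Picard series
(`exists_fourier_modes`). The matrix `H₂ - 2πξ H₁` is Hermitian, so `‖V‖` is constant, and
`w(t, p) = ∫ e^{2πiξp} · 2/(1 + (2πξ)²) · V(t, ξ) dξ` converges absolutely. Fourier inversion for
`e^{-|p|}` gives the initial datum, and the smoothness of the test functions absorbs the factor `ξ`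
in the equation of the modes (`hasDerivAt_integral_smul_superposition`).
-/


/-! ### Energy estimate on a shrinking interval -/

/-- The `C¹` cutoff `x ↦ max(x, 0)²`. -/
noncomputable def cutoff (x : ℝ) : ℝ := (max x 0) ^ 2

lemma cutoff_of_nonpos {x : ℝ} (hx : x ≤ 0) : cutoff x = 0 := by
  simp [cutoff, max_eq_right hx]

lemma cutoff_nonneg (x : ℝ) : 0 ≤ cutoff x := sq_nonneg _

lemma cutoff_pos {x : ℝ} (hx : 0 < x) : 0 < cutoff x := by
  simp only [cutoff, max_eq_left hx.le]; positivity

@[fun_prop]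
lemma continuous_cutoff : Continuous cutoff := by unfold cutoff; fun_prop

lemma hasDerivAt_cutoff (x : ℝ) : HasDerivAt cutoff (2 * max x 0) x := by
  rcases lt_trichotomy x 0 with hx | rfl | hx
  · rw [max_eq_right hx.le, mul_zero]
    refine (hasDerivAt_const x (0 : ℝ)).congr_of_eventuallyEq ?_
    filter_upwards [Iio_mem_nhds hx] with y hy using cutoff_of_nonpos (le_of_lt hy)
  · have h0 : cutoff 0 = 0 := cutoff_of_nonpos le_rfl
    rw [hasDerivAt_iff_isLittleO]
    simp only [h0, max_self, mul_zero, smul_zero, sub_zero]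
    have h1 : (fun x : ℝ => cutoff x) =O[nhds 0] fun x => x ^ 2 := by
      refine Asymptotics.isBigO_of_le _ fun y => ?_
      simp only [cutoff, Real.norm_eq_abs, abs_pow]
      refine pow_le_pow_left₀ (abs_nonneg _) ?_ 2
      rw [abs_of_nonneg (le_max_right y 0)]
      exact max_le (le_abs_self y) (abs_nonneg y)
    exact h1.trans_isLittleO (Asymptotics.isLittleO_pow_id one_lt_two)
  · rw [max_eq_left hx.le]
    have : HasDerivAt (fun y : ℝ => y ^ 2) (2 * x) x := by simpa using hasDerivAt_pow 2 x
    refine this.congr_of_eventuallyEq ?_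
    filter_upwards [Ioi_mem_nhds hx] with y hy
    simp [cutoff, max_eq_left (le_of_lt (show (0:ℝ) < y from hy))]

section Energy

variable {E : Type*} [NormedAddCommGroup E] [InnerProductSpace ℝ E]

open scoped RealInnerProductSpace

/-- Domain of dependence for classical solutions of `∂ₜX = K X - H ∂ₚX`, with `H` symmetric and
`K` skew: if `H ≤ lam`, zeros of the initial datum on `(a, ∞)` persist on `(a + lam t, ∞)`.
The energy `∫ m(p - a - lam t) m(R - C t - p) ‖X‖² dp`, `m = cutoff`, is nonincreasing: its weight
travels inwards at least as fast as the characteristics on both sides. -/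
theorem eq_zero_of_symmetric_hyperbolic
    {T lam C a : ℝ} {X Xp : ℝ → ℝ → E} {H K : ℝ → E →L[ℝ] E}
    (hX : Continuous (Function.uncurry X)) (hXp : Continuous (Function.uncurry Xp))
    (hH : Continuous H) (hK : Continuous K)
    (hp : ∀ t p, HasDerivAt (X t) (Xp t p) p)
    (ht : ∀ t ∈ Ioo 0 T, ∀ p, HasDerivAt (fun s => X s p) (K t (X t p) - H t (Xp t p)) t)
    (hsymm : ∀ t x y, ⟪H t x, y⟫ = ⟪x, H t y⟫) (hskew : ∀ t x, ⟪x, K t x⟫ = 0)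
    (hlam : ∀ t ∈ Ioo 0 T, ∀ x, ⟪x, H t x⟫ ≤ lam * ‖x‖ ^ 2)
    (hC : ∀ t ∈ Ioo 0 T, ∀ x, -⟪x, H t x⟫ ≤ C * ‖x‖ ^ 2)
    (hlam0 : 0 ≤ lam) (hC0 : 0 ≤ C) (h0 : ∀ p, a < p → X 0 p = 0) :
    ∀ t ∈ Icc 0 T, ∀ p, a + lam * t < p → X t p = 0 := by
  intro t₀ ht₀ p₀ hp₀
  by_contra hne
  set R := p₀ + C * t₀ + 1 with hR
  have hap : a < p₀ := by nlinarith [ht₀.1, mul_nonneg hlam0 ht₀.1]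
  have hpR : p₀ < R := by nlinarith [mul_nonneg hC0 ht₀.1]
  have haR : a ≤ R := (hap.trans hpR).le
  set G : ℝ → ℝ → ℝ := fun t p =>
    cutoff (p - a - lam * t) * cutoff (R - C * t - p) * ‖X t p‖ ^ 2 with hG
  set G' : ℝ → ℝ → ℝ := fun t p =>
    (2 * max (p - a - lam * t) 0 * (-lam) * cutoff (R - C * t - p)
      + cutoff (p - a - lam * t) * (2 * max (R - C * t - p) 0 * (-C))) * ‖X t p‖ ^ 2
    + cutoff (p - a - lam * t) * cutoff (R - C * t - p)
      * (2 * ⟪X t p, K t (X t p) - H t (Xp t p)⟫) with hG'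
  -- the flux and its `p`-derivative
  set F : ℝ → ℝ → ℝ := fun t p =>
    cutoff (p - a - lam * t) * cutoff (R - C * t - p) * ⟪X t p, H t (X t p)⟫ with hF
  set F' : ℝ → ℝ → ℝ := fun t p =>
    (2 * max (p - a - lam * t) 0 * cutoff (R - C * t - p)
      + cutoff (p - a - lam * t) * (2 * max (R - C * t - p) 0 * (-1))) * ⟪X t p, H t (X t p)⟫
    + cutoff (p - a - lam * t) * cutoff (R - C * t - p)
      * (⟪X t p, H t (Xp t p)⟫ + ⟪Xp t p, H t (X t p)⟫) with hF'
  have cX : Continuous fun z : ℝ × ℝ => X z.1 z.2 := hX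
  have cXp : Continuous fun z : ℝ × ℝ => Xp z.1 z.2 := hXp
  have cHX : Continuous fun z : ℝ × ℝ => H z.1 (X z.1 z.2) :=
    (hH.comp continuous_fst).clm_apply cX
  have cHXp : Continuous fun z : ℝ × ℝ => H z.1 (Xp z.1 z.2) :=
    (hH.comp continuous_fst).clm_apply cXp
  have cKX : Continuous fun z : ℝ × ℝ => K z.1 (X z.1 z.2) :=
    (hK.comp continuous_fst).clm_apply cX
  have cG : Continuous (Function.uncurry G) := by
    simp only [hG, Function.uncurry_def]; fun_prop
  have cG' : Continuous (Function.uncurry G') := by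
    simp only [hG', Function.uncurry_def]; fun_prop
  have cF' : Continuous (Function.uncurry F') := by
    simp only [hF', Function.uncurry_def]; fun_prop
  have dG : ∀ t ∈ Ioo 0 T, ∀ p, HasDerivAt (fun s => G s p) (G' t p) t := by
    intro t htT p
    have e1 : HasDerivAt (fun s => p - a - lam * s) (-lam) t := by
      simpa using ((hasDerivAt_id t).const_mul lam).const_sub (p - a)
    have e2 : HasDerivAt (fun s => R - C * s - p) (-C) t := by
      simpa using (((hasDerivAt_id t).const_mul C).const_sub R).sub_const p
    have d1 := (hasDerivAt_cutoff (p - a - lam * t)).comp t e1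
    have d2 := (hasDerivAt_cutoff (R - C * t - p)).comp t e2
    exact (d1.mul d2).mul (ht t htT p).norm_sq
  have dF : ∀ t p, HasDerivAt (F t) (F' t p) p := by
    intro t p
    have e1 : HasDerivAt (fun q => q - a - lam * t) 1 p := by
      simpa using ((hasDerivAt_id p).sub_const a).sub_const (lam * t)
    have e2 : HasDerivAt (fun q => R - C * t - q) (-1) p := by
      simpa using (hasDerivAt_id p).const_sub (R - C * t)
    have d1 := (hasDerivAt_cutoff (p - a - lam * t)).comp p e1
    have d2 := (hasDerivAt_cutoff (R - C * t - p)).comp p e2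
    have d3 : HasDerivAt (fun q => H t (X t q)) (H t (Xp t p)) p :=
      (H t).hasFDerivAt.comp_hasDerivAt p (hp t p)
    have := (d1.mul d2).mul ((hp t p).inner ℝ d3)
    rw [mul_one] at this
    exact this
  have hsum : ∀ t ∈ Ioo 0 T, ∀ p, G' t p + F' t p ≤ 0 := by
    intro t htT p
    have h1 := hlam t htT (X t p)
    have h2 := hC t htT (X t p)
    have h3 : ⟪Xp t p, H t (X t p)⟫ = ⟪X t p, H t (Xp t p)⟫ := by
      rw [← hsymm, real_inner_comm]
    have h4 := hskew t (X t p)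
    have m1 : 0 ≤ 2 * max (p - a - lam * t) 0 * cutoff (R - C * t - p) :=
      mul_nonneg (mul_nonneg zero_le_two (le_max_right _ _)) (cutoff_nonneg _)
    have m2 : 0 ≤ 2 * max (R - C * t - p) 0 * cutoff (p - a - lam * t) :=
      mul_nonneg (mul_nonneg zero_le_two (le_max_right _ _)) (cutoff_nonneg _)
    have k1 := mul_nonneg m1 (sub_nonneg.2 h1)
    have k2 := mul_nonneg m2 (sub_nonneg.2 h2)
    simp only [hG', hF', inner_sub_right, h3, h4]
    linear_combination k1 + k2
  have dE : ∀ t ∈ Ioo 0 T, HasDerivAt (fun s => ∫ p in a..R, G s p) (∫ p in a..R, G' t p) t := by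
    intro t htT
    obtain ⟨M, hM⟩ := ((isCompact_Icc (a := (0:ℝ)) (b := T)).prod
      (isCompact_Icc (a := a) (b := R))).exists_bound_of_continuousOn cG'.continuousOn
    refine (intervalIntegral.hasDerivAt_integral_of_dominated_loc_of_deriv_le
      (bound := fun _ => M) (s := Ioo 0 T) (Ioo_mem_nhds htT.1 htT.2) ?_ ?_ ?_ ?_ ?_ ?_).2
    · exact Filter.Eventually.of_forall fun s =>
        (cG.comp (Continuous.prodMk_right s)).aestronglyMeasurable
    · exact (cG.comp (Continuous.prodMk_right t)).intervalIntegrable _ _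
    · exact (cG'.comp (Continuous.prodMk_right t)).aestronglyMeasurable
    · refine Filter.Eventually.of_forall fun p hpI s hs => hM (s, p) ⟨⟨hs.1.le, hs.2.le⟩, ?_⟩
      rw [uIoc_of_le haR] at hpI
      exact ⟨hpI.1.le, hpI.2⟩
    · exact intervalIntegrable_const
    · exact Filter.Eventually.of_forall fun p _ s hs => dG s hs p
  have cE : Continuous fun s => ∫ p in a..R, G s p :=
    intervalIntegral.continuous_parametric_intervalIntegral_of_continuous' cG a R
  have E'nonpos : ∀ t ∈ Ioo 0 T, ∫ p in a..R, G' t p ≤ 0 := by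
    intro t htT
    have iG : IntervalIntegrable (G' t) volume a R :=
      (cG'.comp (Continuous.prodMk_right t)).intervalIntegrable _ _
    have iF : IntervalIntegrable (F' t) volume a R :=
      (cF'.comp (Continuous.prodMk_right t)).intervalIntegrable _ _
    have hF0 : ∫ p in a..R, F' t p = 0 := by
      rw [intervalIntegral.integral_eq_sub_of_hasDerivAt (fun p _ => dF t p) iF]
      have z1 : cutoff (a - a - lam * t) = 0 :=
        cutoff_of_nonpos (by nlinarith [mul_nonneg hlam0 htT.1.le])
      have z2 : cutoff (R - C * t - R) = 0 :=
        cutoff_of_nonpos (by nlinarith [mul_nonneg hC0 htT.1.le])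
      simp only [hF, z1, z2, mul_zero, zero_mul, sub_zero]
    have hadd := intervalIntegral.integral_add iG iF
    rw [hF0, add_zero] at hadd
    rw [← hadd, ← neg_nonneg, ← intervalIntegral.integral_neg]
    exact intervalIntegral.integral_nonneg haR fun p _ => neg_nonneg.2 (hsum t htT p)
  have hanti : AntitoneOn (fun s => ∫ p in a..R, G s p) (Icc 0 T) := by
    refine antitoneOn_of_deriv_nonpos (convex_Icc 0 T) cE.continuousOn ?_ ?_
    · rw [interior_Icc]
      exact fun t htT => (dE t htT).differentiableAt.differentiableWithinAt
    · rw [interior_Icc]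
      exact fun t htT => (dE t htT).deriv ▸ E'nonpos t htT
  have hE0 : ∫ p in a..R, G 0 p = 0 := by
    rw [← intervalIntegral.integral_zero (a := a) (b := R)]
    refine intervalIntegral.integral_congr_ae (Filter.Eventually.of_forall fun p hpI => ?_)
    rw [uIoc_of_le haR] at hpI
    simp [hG, h0 p hpI.1]
  have hle := hanti ⟨le_rfl, ht₀.1.trans ht₀.2⟩ ht₀ ht₀.1
  have hpos : 0 < ∫ p in a..R, G t₀ p := by
    refine intervalIntegral.integral_pos (hap.trans hpR)
      (cG.comp (Continuous.prodMk_right t₀)).continuousOn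
      (fun p _ => mul_nonneg (mul_nonneg (cutoff_nonneg _) (cutoff_nonneg _)) (sq_nonneg _))
      ⟨p₀, ⟨hap.le, hpR.le⟩, mul_pos (mul_pos (cutoff_pos (by linarith))
        (cutoff_pos (by rw [hR]; linarith))) (pow_pos (norm_pos_iff.2 hne) 2)⟩
  simp only [hE0] at hle
  exact absurd hpos (not_lt.2 hle)

end Energy

/-! ### Hermitian matrices as operators on Euclidean space -/

/-- A complex matrix as a real-linear operator on `ℂⁿ` with the Euclidean norm; the real inner
product used there is `Re ⟨x, y⟩`. -/
noncomputable def euclidOp {n : ℕ} (M : Matrix (Fin n) (Fin n) ℂ) :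
    EuclideanSpace ℂ (Fin n) →L[ℝ] EuclideanSpace ℂ (Fin n) :=
  (Matrix.toEuclideanCLM (n := Fin n) (𝕜 := ℂ) M).restrictScalars ℝ

section Matrices

open scoped RealInnerProductSpace

variable {n : ℕ} (M : Matrix (Fin n) (Fin n) ℂ)

lemma euclidOp_toLp (x : Fin n → ℂ) :
    euclidOp M (WithLp.toLp 2 x) = WithLp.toLp 2 (M *ᵥ x) := rfl

lemma inner_euclidOp (x y : EuclideanSpace ℂ (Fin n)) :
    ⟪x, euclidOp M y⟫ = (star x.ofLp ⬝ᵥ (M *ᵥ y.ofLp)).re := by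
  rw [PiLp.inner_apply, dotProduct, Complex.re_sum]
  refine Finset.sum_congr rfl fun i _ => ?_
  rw [Complex.inner, mul_comm]
  rfl

lemma continuous_euclidOp : Continuous (euclidOp (n := n)) := by
  let L : Matrix (Fin n) (Fin n) ℂ →ₗ[ℝ]
      (EuclideanSpace ℂ (Fin n) →L[ℝ] EuclideanSpace ℂ (Fin n)) :=
    { toFun := euclidOp
      map_add' := fun A B => by ext x; simp [euclidOp]
      map_smul' := fun c A => by
        refine ContinuousLinearMap.ext fun x => ?_
        exact congrArg (WithLp.toLp 2) (Matrix.smul_mulVec c A x.ofLp) }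
  exact L.continuous_of_finiteDimensional

variable {M}

lemma inner_euclidOp_comm (hM : M.IsHermitian) (x y : EuclideanSpace ℂ (Fin n)) :
    ⟪euclidOp M x, y⟫ = ⟪x, euclidOp M y⟫ := by
  have h : (star y.ofLp ⬝ᵥ (M *ᵥ x.ofLp)) = star (star x.ofLp ⬝ᵥ (M *ᵥ y.ofLp)) := by
    rw [Matrix.star_dotProduct, Matrix.star_mulVec, hM.eq, Matrix.dotProduct_mulVec]
  rw [real_inner_comm, inner_euclidOp, inner_euclidOp, h]
  exact Complex.conj_re _

/-- A complex quadratic form with Hermitian matrix is real, so its multiples by `I` have vanishing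
real part. -/
lemma inner_euclidOp_I_smul (hM : M.IsHermitian) (x : EuclideanSpace ℂ (Fin n)) :
    ⟪x, euclidOp (Complex.I • M) x⟫ = 0 := by
  have h := hM.im_star_dotProduct_mulVec_self x.ofLp
  rw [inner_euclidOp, Matrix.smul_mulVec, dotProduct_smul, smul_eq_mul, Complex.I_mul_re]
  simpa using h

lemma hermPart_isHermitian (M : Matrix (Fin n) (Fin n) ℂ) : (hermPart M).IsHermitian := by
  rw [Matrix.IsHermitian, hermPart, Matrix.conjTranspose_smul, Matrix.conjTranspose_add,
    Matrix.conjTranspose_conjTranspose, add_comm]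
  simp

lemma skewPart_isHermitian (M : Matrix (Fin n) (Fin n) ℂ) : (skewPart M).IsHermitian := by
  rw [Matrix.IsHermitian, skewPart, Matrix.conjTranspose_smul, Matrix.conjTranspose_sub,
    Matrix.conjTranspose_conjTranspose, ← neg_sub M, smul_neg, ← neg_smul]
  congr 1
  simp

lemma hermPart_add_I_smul_skewPart (M : Matrix (Fin n) (Fin n) ℂ) :
    hermPart M + Complex.I • skewPart M = M := by
  have h : Complex.I * (1 / (2 * Complex.I)) = 1 / 2 := by
    field_simp
  rw [hermPart, skewPart, smul_smul, h, ← smul_add]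
  ext i j
  simp
  ring

lemma continuous_hermPart : Continuous (hermPart (n := n)) := by
  unfold hermPart; fun_prop

lemma continuous_skewPart : Continuous (skewPart (n := n)) := by
  unfold skewPart; fun_prop

lemma hasEigenvalue_toLin'_eigenvalues (hM : M.IsHermitian) (i : Fin n) :
    Module.End.HasEigenvalue (Matrix.toLin' M) (hM.eigenvalues i : ℂ) := by
  rw [Module.End.hasEigenvalue_iff_mem_spectrum, Matrix.spectrum_toLin',
    hM.spectrum_eq_image_range]
  exact ⟨_, ⟨i, rfl⟩, rfl⟩

open scoped ComplexOrder in
/-- A bound on the eigenvalues of a Hermitian matrix bounds its quadratic form. -/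
lemma inner_euclidOp_le (hM : M.IsHermitian) {c : ℝ}
    (hc : ∀ l : ℝ, Module.End.HasEigenvalue (Matrix.toLin' M) (l : ℂ) → l ≤ c)
    (x : EuclideanSpace ℂ (Fin n)) : ⟪x, euclidOp M x⟫ ≤ c * ‖x‖ ^ 2 := by
  have hB : ((c : ℂ) • (1 : Matrix (Fin n) (Fin n) ℂ) - M).IsHermitian := by
    refine Matrix.IsHermitian.sub ?_ hM
    rw [Matrix.IsHermitian, Matrix.conjTranspose_smul, Matrix.conjTranspose_one]
    simp
  have hpos : ((c : ℂ) • (1 : Matrix (Fin n) (Fin n) ℂ) - M).PosSemidef := by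
    rw [hB.posSemidef_iff_eigenvalues_nonneg]
    intro i
    have h := hasEigenvalue_toLin'_eigenvalues hB i
    obtain ⟨v, hv⟩ := h.exists_hasEigenvector
    have hv' := hv.apply_eq_smul
    rw [Matrix.toLin'_apply, Matrix.sub_mulVec, Matrix.smul_mulVec, Matrix.one_mulVec] at hv'
    have hMv : Matrix.toLin' M v = ((c - hB.eigenvalues i : ℝ) : ℂ) • v := by
      rw [Matrix.toLin'_apply, Complex.ofReal_sub, sub_smul, ← hv', sub_sub_cancel]
    have := hc _ (Module.End.hasEigenvalue_of_hasEigenvector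
      ⟨Module.End.mem_eigenspace_iff.2 hMv, hv.2⟩)
    simpa using this
  have h := hpos.re_dotProduct_nonneg x.ofLp
  have hx : ‖x‖ ^ 2 = (star x.ofLp ⬝ᵥ x.ofLp).re := by
    rw [← real_inner_self_eq_norm_sq]
    simpa [euclidOp] using inner_euclidOp (1 : Matrix (Fin n) (Fin n) ℂ) x x
  rw [Matrix.sub_mulVec, Matrix.smul_mulVec, Matrix.one_mulVec, dotProduct_sub,
    dotProduct_smul, smul_eq_mul] at h
  rw [inner_euclidOp, hx]
  simpa using h

lemma abs_inner_euclidOp_le (M : Matrix (Fin n) (Fin n) ℂ) (x : EuclideanSpace ℂ (Fin n)) :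
    |⟪x, euclidOp M x⟫| ≤ ‖euclidOp M‖ * ‖x‖ ^ 2 := by
  refine (abs_real_inner_le_norm _ _).trans ?_
  nlinarith [(euclidOp M).le_opNorm x, norm_nonneg x]

lemma le_norm_euclidOp_of_hasEigenvalue {l : ℝ}
    (h : Module.End.HasEigenvalue (Matrix.toLin' M) (l : ℂ)) : |l| ≤ ‖euclidOp M‖ := by
  obtain ⟨v, hv⟩ := h.exists_hasEigenvector
  have hv' := hv.apply_eq_smul
  rw [Matrix.toLin'_apply] at hv'
  have h1 := (euclidOp M).le_opNorm (WithLp.toLp 2 v)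
  rw [euclidOp_toLp, hv', WithLp.toLp_smul, norm_smul, Complex.norm_real, Real.norm_eq_abs] at h1
  have hpos : 0 < ‖(WithLp.toLp 2 v : EuclideanSpace ℂ (Fin n))‖ := by
    rw [norm_pos_iff]
    simpa using hv.2
  exact le_of_mul_le_mul_right h1 hpos

lemma lambdaMaxPlus_nonneg (T : ℝ) (H : ℝ → Matrix (Fin n) (Fin n) ℂ) :
    0 ≤ lambdaMaxPlus T H :=
  le_max_right _ _

/-- The quadratic form of `H(t)` is bounded by `lambdaMaxPlus T H`, for continuous Hermitian `H`.
Continuity makes the set of eigenvalues bounded, so that its supremum is not a junk value. -/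
lemma inner_euclidOp_le_lambdaMaxPlus {T : ℝ} {H : ℝ → Matrix (Fin n) (Fin n) ℂ}
    (hcont : ContinuousOn H (Icc 0 T)) (hH : ∀ t, (H t).IsHermitian) {t : ℝ} (ht : t ∈ Ioo 0 T)
    (x : EuclideanSpace ℂ (Fin n)) :
    ⟪x, euclidOp (H t) x⟫ ≤ lambdaMaxPlus T H * ‖x‖ ^ 2 := by
  obtain ⟨C, hC⟩ := isCompact_Icc.exists_bound_of_continuousOn
    (continuous_euclidOp.comp_continuousOn hcont)
  refine inner_euclidOp_le (hH t) (fun l hl => ?_) x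
  rcases le_or_gt l 0 with h0 | h0
  · exact h0.trans (le_max_right _ _)
  · refine (le_abs_self l).trans (le_max_of_le_left (le_csSup ?_ ⟨t, ht, l, hl, h0, rfl⟩))
    refine ⟨C, ?_⟩
    rintro _ ⟨s, hs, m, hm, -, rfl⟩
    exact (le_norm_euclidOp_of_hasEigenvalue hm).trans (hC s ⟨hs.1.le, hs.2.le⟩)

end Matrices

/-! ### Domain of dependence for weak solutions -/

/-- `w` is a continuous weak solution of `∂ₜ w = - H₁ ∂ₚ w + i H₂ w` on `[0, T] × ℝ`, with no
condition on its initial datum. -/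
structure IsWeakTransport {n : ℕ} (T : ℝ) (A : ℝ → Matrix (Fin n) (Fin n) ℂ)
    (w : ℝ → ℝ → Fin n → ℂ) : Prop where
  continuousOn : ContinuousOn (Function.uncurry w) (Icc 0 T ×ˢ univ)
  weak : ∀ φ : ℝ → ℝ, ContDiff ℝ ∞ φ → HasCompactSupport φ → ∀ t ∈ Icc 0 T,
    HasDerivWithinAt (fun s : ℝ => ∫ p, φ p • w s p)
      (hermPart (A t) *ᵥ (∫ p, deriv φ p • w t p)
        + Complex.I • (skewPart (A t) *ᵥ (∫ p, φ p • w t p)))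
      (Icc 0 T) t

lemma IsTransportSolution.isWeakTransport {n : ℕ} {T : ℝ} {A : ℝ → Matrix (Fin n) (Fin n) ℂ}
    {u₀ : Fin n → ℂ} {w : ℝ → ℝ → Fin n → ℂ} (h : IsTransportSolution T A u₀ w) :
    IsWeakTransport T A w :=
  ⟨h.continuousOn, h.weak⟩

/-- The retraction of the time axis onto `[0, T]`, used to extend functions on `[0, T]`. -/
noncomputable def clampTime (T t : ℝ) : ℝ := max 0 (min T t)

@[fun_prop]
lemma continuous_clampTime (T : ℝ) : Continuous (clampTime T) := by
  unfold clampTime; fun_prop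

lemma clampTime_mem {T : ℝ} (hT : 0 ≤ T) (t : ℝ) : clampTime T t ∈ Icc 0 T :=
  ⟨le_max_left _ _, max_le hT (min_le_left _ _)⟩

lemma clampTime_of_mem {T t : ℝ} (ht : t ∈ Icc 0 T) : clampTime T t = t := by
  rw [clampTime, min_eq_right ht.2, max_eq_right ht.1]

namespace IsWeakTransport

variable {n : ℕ} {T : ℝ} {A : ℝ → Matrix (Fin n) (Fin n) ℂ} {w w' : ℝ → ℝ → Fin n → ℂ}

lemma continuous_slice (h : IsWeakTransport T A w) {t : ℝ} (ht : t ∈ Icc 0 T) :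
    Continuous (w t) :=
  h.continuousOn.comp_continuous (f := fun p => (t, p)) (by fun_prop) fun _ => ⟨ht, mem_univ _⟩

lemma integrable_smul (h : IsWeakTransport T A w) {t : ℝ} (ht : t ∈ Icc 0 T) {φ : ℝ → ℝ}
    (hφ : Continuous φ) (hc : HasCompactSupport φ) : Integrable fun p => φ p • w t p :=
  (hφ.smul (h.continuous_slice ht)).integrable_of_hasCompactSupport hc.smul_right

lemma sub (h : IsWeakTransport T A w) (h' : IsWeakTransport T A w') :
    IsWeakTransport T A fun t p => w t p - w' t p where
  continuousOn := h.continuousOn.sub h'.continuousOn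
  weak φ hφ hc t ht := by
    have key : ∀ ψ : ℝ → ℝ, Continuous ψ → HasCompactSupport ψ → ∀ s ∈ Icc 0 T,
        ∫ p, ψ p • (w s p - w' s p) = (∫ p, ψ p • w s p) - ∫ p, ψ p • w' s p := by
      intro ψ hψ hψc s hs
      simp only [smul_sub]
      exact integral_sub (h.integrable_smul hs hψ hψc) (h'.integrable_smul hs hψ hψc)
    have hd : Continuous (deriv φ) := hφ.continuous_deriv (by simp)
    have := (h.weak φ hφ hc t ht).sub (h'.weak φ hφ hc t ht)
    rw [key φ hφ.continuous hc t ht, key _ hd hc.deriv t ht, Matrix.mulVec_sub, Matrix.mulVec_sub,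
      smul_sub, ← add_sub_add_comm]
    exact this.congr (fun s hs => key φ hφ.continuous hc s hs) (key φ hφ.continuous hc t ht)

open scoped Convolution in
/-- A weak solution vanishing on `(a, ∞)` at time `0` vanishes on `(a + lam t, ∞)` at time `t`, if
`lam ≥ 0` bounds the quadratic forms of `H₁`. Convolution in `p` with a test function turns a weak
solution into a classical one, to which the energy estimate applies; since the test function is
arbitrary, no limit of mollifications is needed. -/
theorem eq_zero_of_initial_eq_zero (h : IsWeakTransport T A w) (hT : 0 ≤ T)
    (hA : ContinuousOn A (Icc 0 T)) {lam a : ℝ} (hlam0 : 0 ≤ lam)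
    (hlam : ∀ t ∈ Ioo 0 T, ∀ x, inner ℝ x (euclidOp (hermPart (A t)) x) ≤ lam * ‖x‖ ^ 2)
    (h0 : ∀ p, a < p → w 0 p = 0) :
    ∀ t ∈ Icc 0 T, ∀ p, a + lam * t < p → w t p = 0 := by
  -- continuous extensions of the solution and of the coefficients to all times
  set v : ℝ → ℝ → Fin n → ℂ := fun t => w (clampTime T t) with hv
  set B : ℝ → Matrix (Fin n) (Fin n) ℂ := fun t => A (clampTime T t) with hB
  have cB : Continuous B :=
    hA.comp_continuous (continuous_clampTime T) (clampTime_mem hT)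
  have cv : Continuous fun z : ℝ × ℝ => v z.1 z.2 :=
    h.continuousOn.comp_continuous (f := fun z : ℝ × ℝ => (clampTime T z.1, z.2)) (by fun_prop)
      fun z => ⟨clampTime_mem hT _, mem_univ _⟩
  have cvt : ∀ t, Continuous (v t) := fun t => cv.comp (Continuous.prodMk_right t)
  have hvt : ∀ t ∈ Icc 0 T, v t = w t := fun t ht => by simp only [hv, clampTime_of_mem ht]
  have hBt : ∀ t ∈ Icc 0 T, B t = A t := fun t ht => by simp only [hB, clampTime_of_mem ht]
  have cH : Continuous fun t => euclidOp (hermPart (B t)) :=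
    continuous_euclidOp.comp (continuous_hermPart.comp cB)
  have cK : Continuous fun t => euclidOp (Complex.I • skewPart (B t)) :=
    continuous_euclidOp.comp ((continuous_skewPart.comp cB).const_smul Complex.I)
  obtain ⟨C, hC⟩ := (isCompact_Icc (a := (0 : ℝ)) (b := T)).exists_bound_of_continuousOn
    cH.continuousOn
  have hC0 : 0 ≤ C := (norm_nonneg _).trans (hC 0 ⟨le_rfl, hT⟩)
  let e : (Fin n → ℂ) →L[ℝ] EuclideanSpace ℂ (Fin n) :=
    (PiLp.continuousLinearEquiv 2 ℝ (fun _ : Fin n => ℂ)).symm.toContinuousLinearMap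
  have he : ∀ x, e x = WithLp.toLp 2 x := fun _ => rfl
  -- the convolutions of the solution with `ψ` and with `ψ'`
  have conv_cont : ∀ ψ : ℝ → ℝ, Continuous ψ → HasCompactSupport ψ →
      Continuous (Function.uncurry fun t p => ∫ y, ψ y • v t (p - y)) := by
    intro ψ hψ hψc
    have hcont : Continuous (Function.uncurry fun (z : ℝ × ℝ) y => ψ y • v z.1 (z.2 - y)) := by
      refine Continuous.smul (hψ.comp continuous_snd) (cv.comp (?_ :
        Continuous fun q : (ℝ × ℝ) × ℝ => (q.1.1, q.1.2 - q.2)))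
      fun_prop
    have := continuous_parametric_integral_of_continuous (μ := volume) hcont hψc.isCompact
    refine this.congr fun z => ?_
    refine setIntegral_eq_integral_of_forall_compl_eq_zero fun y hy => ?_
    rw [image_eq_zero_of_notMem_tsupport hy, zero_smul]
  have conv_swap : ∀ (ψ : ℝ → ℝ) t p,
      ∫ y, ψ y • v t (p - y) = ∫ q, ψ (p - q) • v t q := by
    intro ψ t p
    rw [← integral_sub_left_eq_self (fun y => ψ y • v t (p - y)) volume p]
    simp
  have main : ∀ ψ : ℝ → ℝ, ContDiff ℝ ∞ ψ → HasCompactSupport ψ → ∀ b : ℝ,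
      (∀ p, b < p → ∫ q, ψ (p - q) • v 0 q = 0) →
      ∀ t ∈ Icc 0 T, ∀ p, b + lam * t < p → ∫ q, ψ (p - q) • v t q = 0 := by
    intro ψ hψ hψc b hb t ht p hp
    have hψd : Continuous (deriv ψ) := hψ.continuous_deriv (by simp)
    have key := eq_zero_of_symmetric_hyperbolic (T := T) (lam := lam) (C := C) (a := b)
      (X := fun t p => e (∫ y, ψ y • v t (p - y)))
      (Xp := fun t p => e (∫ y, deriv ψ y • v t (p - y)))
      (H := fun t => euclidOp (hermPart (B t)))
      (K := fun t => euclidOp (Complex.I • skewPart (B t)))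
      (e.continuous.comp (conv_cont ψ hψ.continuous hψc))
      (e.continuous.comp (conv_cont _ hψd hψc.deriv)) cH cK ?_ ?_ ?_ ?_ ?_ ?_ hlam0 hC0 ?_ t ht p hp
    · have := congrArg WithLp.ofLp key
      rw [← conv_swap]
      exact this
    · intro t p
      exact e.hasFDerivAt.comp_hasDerivAt p
        (hψc.hasDerivAt_convolution_left (ContinuousLinearMap.lsmul ℝ ℝ)
          (hψ.of_le (by simp)) (cvt t).locallyIntegrable p)
    · intro t ht p
      have ht' : t ∈ Icc 0 T := ⟨ht.1.le, ht.2.le⟩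
      have hd : deriv (fun q => ψ (p - q)) = fun q => -deriv ψ (p - q) := by
        funext q
        exact deriv_comp_const_sub ψ p q
      have hsupp : HasCompactSupport fun q => ψ (p - q) :=
        hψc.comp_homeomorph (Homeomorph.subLeft p)
      have hw := (h.weak (fun q => ψ (p - q)) (hψ.comp (contDiff_const.sub contDiff_id)) hsupp
        t ht').hasDerivAt (Icc_mem_nhds ht.1 ht.2)
      simp only [hd, neg_smul, integral_neg] at hw
      have hev : (fun s => ∫ y, ψ y • v s (p - y)) =ᶠ[nhds t]
          fun s => ∫ q, ψ (p - q) • w s q := by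
        filter_upwards [Icc_mem_nhds ht.1 ht.2] with s hs
        rw [conv_swap, hvt s hs]
      have hw2 := e.hasFDerivAt.comp_hasDerivAt t (hw.congr_of_eventuallyEq hev)
      refine hw2.congr_deriv ?_
      rw [he, he, euclidOp_toLp, euclidOp_toLp, he, conv_swap, conv_swap, hvt t ht', hBt t ht',
        ← WithLp.toLp_sub, Matrix.mulVec_neg, Matrix.smul_mulVec, neg_add_eq_sub]
    · exact fun t x y => inner_euclidOp_comm (hermPart_isHermitian _) x y
    · exact fun t x => inner_euclidOp_I_smul (skewPart_isHermitian _) x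
    · intro t ht x
      rw [hBt t ⟨ht.1.le, ht.2.le⟩]
      exact hlam t ht x
    · intro t ht x
      refine (neg_le_abs _).trans ((abs_inner_euclidOp_le _ x).trans ?_)
      exact mul_le_mul_of_nonneg_right (hC t ⟨ht.1.le, ht.2.le⟩) (sq_nonneg _)
    · intro p hp
      simp only [conv_swap, hb p hp, map_zero]
  intro t ht p hp
  have hae : ∀ᵐ q, q ∈ Ioi (a + lam * t) → w t q = 0 := by
    refine isOpen_Ioi.ae_eq_zero_of_integral_contDiff_smul_eq_zero
      ((h.continuous_slice ht).locallyIntegrable.locallyIntegrableOn _) fun φ hφ hφc hφs => ?_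
    rcases (tsupport φ).eq_empty_or_nonempty with hemp | hne
    · simp [tsupport_eq_empty_iff.1 hemp]
    obtain ⟨m, hm, hmin⟩ := hφc.isCompact.exists_isLeast hne
    have hm' : a + lam * t < m := hφs hm
    have := main (fun y => φ (-y)) (hφ.comp contDiff_neg)
      (hφc.comp_homeomorph (Homeomorph.neg ℝ)) (a - m) ?_ t ht 0 (by linarith)
    · simpa [hvt t ht] using this
    · intro r hr
      rw [hvt 0 ⟨le_rfl, hT⟩]
      refine integral_eq_zero_of_ae (Filter.Eventually.of_forall fun q => ?_)
      by_cases hq : a < q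
      · simp [h0 q hq]
      · have hφ0 : φ (-(r - q)) = 0 :=
          image_eq_zero_of_notMem_tsupport fun hmem => by
            have := hmin hmem
            linarith
        simp only [hφ0, zero_smul, Pi.zero_apply]
  -- a continuous function vanishing almost everywhere on an open set vanishes there
  have hcont := (h.continuous_slice ht)
  have heq : EqOn (w t) (fun _ => 0) (Ioi (a + lam * t)) :=
    Measure.eqOn_open_of_ae_eq (μ := volume) ((ae_restrict_iff' measurableSet_Ioi).2 hae)
      isOpen_Ioi hcont.continuousOn continuousOn_const
  exact heq hp

end IsWeakTransport

/-! ### Solutions of linear differential equations with a parameter -/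

section LinearODE

variable {F : Type*} [NormedAddCommGroup F] [NormedSpace ℝ F]

/-- The terms of the Picard series of `∂ₜV(t, ξ) = B(t, ξ) V(t, ξ)`, `V(0, ξ) = x`. -/
noncomputable def picardTerm (B : ℝ → ℝ → F →L[ℝ] F) (x : F) : ℕ → ℝ → ℝ → F
  | 0 => fun _ _ => x
  | k + 1 => fun t ξ => ∫ s in (0 : ℝ)..t, B s ξ (picardTerm B x k s ξ)

variable {B : ℝ → ℝ → F →L[ℝ] F} {x : F}

lemma continuous_picardTerm (hB : Continuous (Function.uncurry B)) (k : ℕ) :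
    Continuous (Function.uncurry (picardTerm B x k)) := by
  induction k with
  | zero => exact continuous_const
  | succ k ih =>
    refine intervalIntegral.continuous_parametric_intervalIntegral_of_continuous
      (f := fun (z : ℝ × ℝ) s => B s z.2 (picardTerm B x k s z.2)) ?_ continuous_fst
    exact (hB.comp (by fun_prop : Continuous fun q : (ℝ × ℝ) × ℝ => (q.2, q.1.2))).clm_apply
      (ih.comp (by fun_prop : Continuous fun q : (ℝ × ℝ) × ℝ => (q.2, q.1.2)))

lemma norm_picardTerm_le {M R ξ : ℝ} (hM : ∀ s ∈ Icc (-R) R, ‖B s ξ‖ ≤ M) (hM0 : 0 ≤ M) (k : ℕ) :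
    ∀ t ∈ Icc (-R) R, ‖picardTerm B x k t ξ‖ ≤ ‖x‖ * ((M * |t|) ^ k / k.factorial) := by
  induction k with
  | zero => intro t _; simp [picardTerm]
  | succ k ih =>
    intro t ht
    have hR : 0 ≤ R := by linarith [ht.1, ht.2]
    -- the primitive of the bound on the previous term
    have hint : |∫ s in (0 : ℝ)..t, ‖x‖ * M ^ (k + 1) / k.factorial * |s| ^ k| =
        ‖x‖ * ((M * |t|) ^ (k + 1) / (k + 1).factorial) := by
      have habs : ∀ u : ℝ, 0 ≤ u → ∫ s in (0 : ℝ)..u, |s| ^ k = u ^ (k + 1) / (k + 1) := by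
        intro u hu
        rw [intervalIntegral.integral_congr (g := fun s => s ^ k), integral_pow]
        · simp
        · intro s hs
          rw [uIcc_of_le hu] at hs
          simp only [abs_of_nonneg hs.1]
      have hval : |∫ s in (0 : ℝ)..t, |s| ^ k| = |t| ^ (k + 1) / (k + 1) := by
        rcases le_total 0 t with h | h
        · rw [habs t h, abs_of_nonneg h, abs_of_nonneg (by positivity)]
        · have := intervalIntegral.integral_comp_neg (a := 0) (b := t) fun s : ℝ => |s| ^ k
          simp only [abs_neg, neg_zero] at this
          rw [this, intervalIntegral.integral_symm, habs (-t) (by linarith), abs_neg,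
            abs_of_nonpos h, abs_of_nonneg (by have : 0 ≤ -t := by linarith
                                               positivity)]
      rw [intervalIntegral.integral_const_mul, abs_mul, hval, abs_of_nonneg (by positivity),
        Nat.factorial_succ, mul_pow]
      push_cast
      field_simp
    rw [← hint]
    refine intervalIntegral.norm_integral_le_abs_of_norm_le ?_ (Continuous.intervalIntegrable
      (by fun_prop) _ _)
    refine (ae_restrict_iff' measurableSet_uIoc).2 (Filter.Eventually.of_forall fun s hs => ?_)
    have hsR : s ∈ Icc (-R) R := by
      have h1 : s ∈ uIcc 0 t := uIoc_subset_uIcc hs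
      exact uIcc_subset_Icc ⟨by linarith, hR⟩ ht h1
    calc ‖B s ξ (picardTerm B x k s ξ)‖ ≤ ‖B s ξ‖ * ‖picardTerm B x k s ξ‖ :=
          (B s ξ).le_opNorm _
      _ ≤ M * (‖x‖ * ((M * |s|) ^ k / k.factorial)) :=
          mul_le_mul (hM s hsR) (ih s hsR) (norm_nonneg _) hM0
      _ = _ := by rw [mul_pow]; ring

/-- A linear differential equation whose coefficients depend continuously on time and on a
parameter has a solution, jointly continuous in time and the parameter. -/
theorem exists_hasDerivAt_linear_ode_param [CompleteSpace F]
    (hB : Continuous (Function.uncurry B)) (x : F) :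
    ∃ V : ℝ → ℝ → F, Continuous (Function.uncurry V) ∧ (∀ ξ, V 0 ξ = x) ∧
      ∀ t ξ, HasDerivAt (fun s => V s ξ) (B t ξ (V t ξ)) t := by
  have hloc : ∀ R : ℝ, 0 < R → ∃ M, 0 ≤ M ∧ ∀ t ∈ Icc (-R) R, ∀ ξ ∈ Icc (-R) R, ∀ k,
      ‖picardTerm B x k t ξ‖ ≤ ‖x‖ * ((M * R) ^ k / k.factorial) := by
    intro R hR
    obtain ⟨M, hM⟩ := ((isCompact_Icc (a := -R) (b := R)).prod
      (isCompact_Icc (a := -R) (b := R))).exists_bound_of_continuousOn hB.continuousOn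
    have hM0 : 0 ≤ M := (norm_nonneg _).trans
      (hM (0, 0) ⟨⟨by linarith, hR.le⟩, ⟨by linarith, hR.le⟩⟩)
    refine ⟨M, hM0, fun t ht ξ hξ k =>
      (norm_picardTerm_le (fun s hs => hM (s, ξ) ⟨hs, hξ⟩) hM0 k t ht).trans ?_⟩
    have : |t| ≤ R := abs_le.2 ht
    gcongr
  have hsummable : ∀ c : ℝ, Summable fun k : ℕ => ‖x‖ * (c ^ k / k.factorial) := fun c =>
    (Real.summable_pow_div_factorial c).mul_left _
  have hpt : ∀ t ξ, Summable fun k => picardTerm B x k t ξ := by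
    intro t ξ
    obtain ⟨M, -, hM⟩ := hloc (|t| + |ξ| + 1) (by positivity)
    refine Summable.of_norm_bounded (hsummable _) (hM t ?_ ξ ?_)
    · rw [mem_Icc, ← abs_le]; linarith [abs_nonneg ξ]
    · rw [mem_Icc, ← abs_le]; linarith [abs_nonneg t]
  set V : ℝ → ℝ → F := fun t ξ => ∑' k, picardTerm B x k t ξ with hV
  have cV : Continuous (Function.uncurry V) := by
    rw [continuous_iff_continuousAt]
    rintro ⟨t, ξ⟩
    set R := |t| + |ξ| + 1 with hR
    obtain ⟨M, -, hM⟩ := hloc R (by positivity)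
    refine (continuousOn_tsum (f := fun k (z : ℝ × ℝ) => picardTerm B x k z.1 z.2)
      (s := Icc (-R) R ×ˢ Icc (-R) R) (fun k => (continuous_picardTerm hB k).continuousOn)
      (hsummable (M * R)) fun k z hz => hM z.1 hz.1 z.2 hz.2 k).continuousAt
      (prod_mem_nhds (Icc_mem_nhds ?_ ?_) (Icc_mem_nhds ?_ ?_))
    all_goals
      linarith [neg_abs_le t, le_abs_self t, neg_abs_le ξ, le_abs_self ξ, abs_nonneg t,
        abs_nonneg ξ]
  have hBV : ∀ ξ, Continuous fun s => B s ξ (V s ξ) := fun ξ =>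
    (hB.comp (Continuous.prodMk_left ξ)).clm_apply (cV.comp (Continuous.prodMk_left ξ))
  have hint : ∀ t ξ, V t ξ = x + ∫ s in (0 : ℝ)..t, B s ξ (V s ξ) := by
    intro t ξ
    set R := |t| + |ξ| + 1 with hR
    have hRpos : 0 < R := by positivity
    obtain ⟨M, -, hM⟩ := hloc R hRpos
    have hξ : ξ ∈ Icc (-R) R := by rw [mem_Icc, ← abs_le]; linarith [abs_nonneg t]
    have htR : t ∈ Icc (-R) R := by rw [mem_Icc, ← abs_le]; linarith [abs_nonneg ξ]
    have hBξ : Continuous fun s => B s ξ := hB.comp (Continuous.prodMk_left ξ)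
    obtain ⟨N, hN⟩ := (isCompact_Icc (a := -R) (b := R)).exists_bound_of_continuousOn
      hBξ.continuousOn
    have hN0 : 0 ≤ N := (norm_nonneg _).trans (hN ξ hξ)
    have key : HasSum (fun k => ∫ s in (0 : ℝ)..t, B s ξ (picardTerm B x k s ξ))
        (∫ s in (0 : ℝ)..t, B s ξ (V s ξ)) := by
      refine intervalIntegral.hasSum_integral_of_dominated_convergence
        (fun k _ => N * (‖x‖ * ((M * R) ^ k / k.factorial))) (fun k => ?_) (fun k => ?_) ?_ ?_ ?_
      · exact (hBξ.clm_apply ((continuous_picardTerm hB k).comp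
          (Continuous.prodMk_left ξ))).aestronglyMeasurable
      · refine Filter.Eventually.of_forall fun s hs => ?_
        have hsR : s ∈ Icc (-R) R :=
          uIcc_subset_Icc ⟨by linarith, hRpos.le⟩ htR (uIoc_subset_uIcc hs)
        exact ((B s ξ).le_opNorm _).trans
          (mul_le_mul (hN s hsR) (hM s hsR ξ hξ k) (norm_nonneg _) hN0)
      · exact Filter.Eventually.of_forall fun s _ => (hsummable _).mul_left N
      · exact intervalIntegrable_const
      · exact Filter.Eventually.of_forall fun s _ => (B s ξ).hasSum (hpt s ξ).hasSum
    rw [← key.tsum_eq]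
    exact (hpt t ξ).tsum_eq_zero_add
  refine ⟨V, cV, fun ξ => by rw [hint]; simp, fun t ξ => ?_⟩
  have h1 := (intervalIntegral.integral_hasDerivAt_right ((hBV ξ).intervalIntegrable 0 t)
    ((hBV ξ).stronglyMeasurableAtFilter _ _) (hBV ξ).continuousAt).const_add x
  exact h1.congr_of_eventuallyEq (Filter.Eventually.of_forall fun s => hint s ξ)

end LinearODE

/-! ### The Fourier transform of the initial datum -/

/-- The Fourier transform `2 / (1 + (2πξ)²)` of `e^{-|p|}`. -/
noncomputable def lorentzian (ξ : ℝ) : ℝ := 2 / (1 + (2 * Real.pi * ξ) ^ 2)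

@[fun_prop]
lemma continuous_lorentzian : Continuous lorentzian := by
  unfold lorentzian
  exact continuous_const.div (by fun_prop) fun ξ => by positivity

lemma integrable_lorentzian : Integrable lorentzian := by
  have h := (integrable_inv_one_add_sq.comp_mul_left' (R := 2 * Real.pi)
    (by positivity)).const_mul 2
  exact h.congr (Filter.Eventually.of_forall fun ξ => by simp [lorentzian, div_eq_mul_inv])

/-- The character `p ↦ e^{2πiξp}`. -/
noncomputable def planeWave (ξ p : ℝ) : ℂ := Complex.exp (↑(2 * Real.pi * ξ * p) * Complex.I)

lemma norm_planeWave (ξ p : ℝ) : ‖planeWave ξ p‖ = 1 := Complex.norm_exp_ofReal_mul_I _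

@[fun_prop]
lemma continuous_planeWave : Continuous fun z : ℝ × ℝ => planeWave z.1 z.2 := by
  unfold planeWave; fun_prop

lemma hasDerivAt_planeWave (ξ p : ℝ) :
    HasDerivAt (planeWave ξ) (2 * Real.pi * ξ * Complex.I * planeWave ξ p) p := by
  have h1 : HasDerivAt (fun q : ℝ => ((2 * Real.pi * ξ * q : ℝ) : ℂ) * Complex.I)
      (2 * Real.pi * ξ * Complex.I) p := by
    have := (((hasDerivAt_id p).const_mul (2 * Real.pi * ξ)).ofReal_comp).mul_const Complex.I
    simpa using this
  exact h1.cexp.congr_deriv (mul_comm _ _)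

lemma integrable_exp_neg_abs : Integrable fun p : ℝ => Real.exp (-|p|) := by
  have h1 : IntegrableOn (fun p : ℝ => Real.exp (-|p|)) (Iic 0) :=
    (integrableOn_exp_mul_Iic one_pos 0).congr_fun
      (fun p hp => by simp [abs_of_nonpos (show p ≤ 0 from hp)]) measurableSet_Iic
  have h2 : IntegrableOn (fun p : ℝ => Real.exp (-|p|)) (Ioi 0) :=
    (integrableOn_exp_mul_Ioi (a := -1) (by norm_num) 0).congr_fun
      (fun p hp => by simp [abs_of_pos (show 0 < p from hp)]) measurableSet_Ioi
  rw [← integrableOn_univ, ← Iic_union_Ioi (a := (0 : ℝ))]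
  exact h1.union h2

open scoped FourierTransform in
lemma fourier_exp_neg_abs (ξ : ℝ) :
    𝓕 (fun p : ℝ => (Real.exp (-|p|) : ℂ)) ξ = lorentzian ξ := by
  rw [Real.fourier_real_eq_integral_exp_smul]
  have hint : Integrable fun p : ℝ =>
      Complex.exp (↑(-2 * Real.pi * p * ξ) * Complex.I) • (Real.exp (-|p|) : ℂ) := by
    refine integrable_exp_neg_abs.mono' (Continuous.aestronglyMeasurable (by fun_prop))
      (Filter.Eventually.of_forall fun p => ?_)
    rw [norm_smul, Complex.norm_exp_ofReal_mul_I, one_mul, Complex.norm_real, Real.norm_eq_abs,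
      abs_of_pos (Real.exp_pos _)]
  have hneg : ∫ p : ℝ in Iic 0,
      Complex.exp (↑(-2 * Real.pi * p * ξ) * Complex.I) • (Real.exp (-|p|) : ℂ)
      = ∫ p : ℝ in Iic 0, Complex.exp ((1 - 2 * Real.pi * ξ * Complex.I) * p) := by
    refine setIntegral_congr_fun measurableSet_Iic fun p hp => ?_
    simp only [abs_of_nonpos (show p ≤ 0 from hp), smul_eq_mul, Complex.ofReal_exp,
      ← Complex.exp_add]
    congr 1; push_cast; ring
  have hpos : ∫ p : ℝ in Ioi 0,
      Complex.exp (↑(-2 * Real.pi * p * ξ) * Complex.I) • (Real.exp (-|p|) : ℂ)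
      = ∫ p : ℝ in Ioi 0, Complex.exp ((-1 - 2 * Real.pi * ξ * Complex.I) * p) := by
    refine setIntegral_congr_fun measurableSet_Ioi fun p hp => ?_
    simp only [abs_of_pos (show 0 < p from hp), smul_eq_mul, Complex.ofReal_exp,
      ← Complex.exp_add]
    congr 1; push_cast; ring
  rw [← intervalIntegral.integral_Iic_add_Ioi hint.integrableOn hint.integrableOn, hneg, hpos,
    integral_exp_mul_complex_Iic (by simp), integral_exp_mul_complex_Ioi (by simp)]
  have h1 : (1 - 2 * Real.pi * ξ * Complex.I : ℂ) ≠ 0 := fun h => by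
    have := congrArg Complex.re h
    simp at this
  have h2 : (-1 - 2 * Real.pi * ξ * Complex.I : ℂ) ≠ 0 := fun h => by
    have := congrArg Complex.re h
    simp at this
  have h3 : (1 + (2 * Real.pi * ξ) ^ 2 : ℂ) ≠ 0 := by
    have : (1 + (2 * Real.pi * ξ) ^ 2 : ℝ) ≠ 0 := by positivity
    exact_mod_cast this
  simp only [Complex.ofReal_zero, mul_zero, Complex.exp_zero, lorentzian]
  push_cast
  rw [div_add_div _ _ h1 h2, div_eq_div_iff (mul_ne_zero h1 h2) h3]
  linear_combination (-2 * (2 * Real.pi * ξ) ^ 2 : ℂ) * Complex.I_sq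

open scoped FourierTransform in
lemma integral_planeWave_mul_lorentzian (p : ℝ) :
    ∫ ξ, planeWave ξ p * lorentzian ξ = Real.exp (-|p|) := by
  have h𝓕 : 𝓕 (fun p : ℝ => (Real.exp (-|p|) : ℂ)) = fun ξ => (lorentzian ξ : ℂ) :=
    funext fourier_exp_neg_abs
  have h := Continuous.fourierInv_fourier_eq (f := fun p : ℝ => (Real.exp (-|p|) : ℂ))
    (by fun_prop) integrable_exp_neg_abs.ofReal (h𝓕 ▸ integrable_lorentzian.ofReal)
  rw [h𝓕] at h
  have hp := congrFun h p
  rw [Real.fourierInv_eq'] at hp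
  rw [← hp]
  refine integral_congr_ae (Filter.Eventually.of_forall fun ξ => ?_)
  simp [planeWave, mul_comm, mul_assoc, mul_left_comm]

/-- The Fourier integral `∫ e^{2πiξp} φ(p) dp` of a real function. -/
noncomputable def waveTransform (φ : ℝ → ℝ) (ξ : ℝ) : ℂ := ∫ p, planeWave ξ p * φ p

lemma norm_waveTransform_le (φ : ℝ → ℝ) (ξ : ℝ) : ‖waveTransform φ ξ‖ ≤ ∫ p, ‖φ p‖ := by
  refine (norm_integral_le_integral_norm _).trans (le_of_eq ?_)
  simp [norm_planeWave]

lemma continuous_waveTransform {φ : ℝ → ℝ} (hφ : Integrable φ) (hc : Continuous φ) :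
    Continuous (waveTransform φ) := by
  refine continuous_of_dominated (bound := fun p => ‖φ p‖) (fun ξ => ?_) (fun ξ => ?_) hφ.norm
    (Filter.Eventually.of_forall fun p => ?_)
  · have : Continuous (planeWave ξ) := continuous_planeWave.comp (Continuous.prodMk_right ξ)
    exact Continuous.aestronglyMeasurable (by fun_prop)
  · exact Filter.Eventually.of_forall fun p => by simp [norm_planeWave]
  · exact (continuous_planeWave.comp (Continuous.prodMk_left p)).mul_const _

lemma waveTransform_deriv {φ : ℝ → ℝ} (hφ : ContDiff ℝ 1 φ) (hc : HasCompactSupport φ) (ξ : ℝ) :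
    waveTransform (deriv φ) ξ = -(2 * Real.pi * ξ * Complex.I) * waveTransform φ ξ := by
  have cw : Continuous (planeWave ξ) := continuous_planeWave.comp (Continuous.prodMk_right ξ)
  have cd : Continuous (deriv φ) := hφ.continuous_deriv le_rfl
  have c0 : Continuous φ := hφ.continuous
  have key := integral_mul_deriv_eq_deriv_mul_of_integrable (u := planeWave ξ)
    (v := fun p => (φ p : ℂ)) (u' := fun p => 2 * Real.pi * ξ * Complex.I * planeWave ξ p)
    (v' := fun p => ((deriv φ p : ℝ) : ℂ)) (fun p _ => hasDerivAt_planeWave ξ p)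
    (fun p _ => ((hφ.differentiable one_ne_zero p).hasDerivAt).ofReal_comp) ?_ ?_ ?_
  · rw [waveTransform, key, waveTransform, ← integral_const_mul, ← integral_neg]
    refine integral_congr_ae (Filter.Eventually.of_forall fun p => ?_)
    simp only
    ring
  · refine Continuous.integrable_of_hasCompactSupport (by fun_prop) ?_
    exact (hc.deriv.comp_left Complex.ofReal_zero).mul_left
  · refine Continuous.integrable_of_hasCompactSupport (by fun_prop) ?_
    exact (hc.comp_left Complex.ofReal_zero).mul_left
  · refine Continuous.integrable_of_hasCompactSupport (by fun_prop) ?_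
    exact (hc.comp_left Complex.ofReal_zero).mul_left

/-! ### Existence -/

lemma euclidOp_apply_smul {n : ℕ} (M : Matrix (Fin n) (Fin n) ℂ) (c : ℂ)
    (x : EuclideanSpace ℂ (Fin n)) : euclidOp M (c • x) = c • euclidOp M x :=
  map_smul (Matrix.toEuclideanCLM (n := Fin n) (𝕜 := ℂ) M) c x

/-- Fourier modes of the transport system: for continuous coefficients there are solutions of
`∂ₜV = i (H₂ - 2πξ H₁) V` with prescribed initial value, jointly continuous in `(t, ξ)` and of
constant norm, because `H₂ - 2πξ H₁` is Hermitian. -/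
theorem exists_fourier_modes {n : ℕ} {B : ℝ → Matrix (Fin n) (Fin n) ℂ} (hB : Continuous B)
    (x : EuclideanSpace ℂ (Fin n)) :
    ∃ V : ℝ → ℝ → EuclideanSpace ℂ (Fin n), Continuous (Function.uncurry V) ∧
      (∀ ξ, V 0 ξ = x) ∧ (∀ t ξ, ‖V t ξ‖ = ‖x‖) ∧
      ∀ t ξ, HasDerivAt (fun s => V s ξ)
        (-(2 * Real.pi * ξ * Complex.I) • euclidOp (hermPart (B t)) (V t ξ)
          + euclidOp (Complex.I • skewPart (B t)) (V t ξ)) t := by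
  set S : ℝ → ℝ → Matrix (Fin n) (Fin n) ℂ := fun t ξ =>
    skewPart (B t) - (2 * Real.pi * ξ : ℂ) • hermPart (B t) with hS
  have cS : Continuous (Function.uncurry fun t ξ => euclidOp (Complex.I • S t ξ)) := by
    refine continuous_euclidOp.comp ?_
    have h1 : Continuous fun z : ℝ × ℝ => skewPart (B z.1) :=
      continuous_skewPart.comp (hB.comp continuous_fst)
    have h2 : Continuous fun z : ℝ × ℝ => hermPart (B z.1) :=
      continuous_hermPart.comp (hB.comp continuous_fst)
    have h3 : Continuous fun z : ℝ × ℝ => (2 * Real.pi * z.2 : ℂ) := by fun_prop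
    exact (h1.sub (h3.smul h2)).const_smul Complex.I
  have hSherm : ∀ t ξ, (S t ξ).IsHermitian := by
    intro t ξ
    refine (skewPart_isHermitian _).sub ?_
    rw [Matrix.IsHermitian, Matrix.conjTranspose_smul, (hermPart_isHermitian _).eq]
    simp
  obtain ⟨V, cV, hV0, hV⟩ := exists_hasDerivAt_linear_ode_param cS x
  refine ⟨V, cV, hV0, fun t ξ => ?_, fun t ξ => (hV t ξ).congr_deriv ?_⟩
  · have hd : ∀ s, HasDerivAt (fun s => ‖V s ξ‖ ^ 2) 0 s := fun s =>
      (hV s ξ).norm_sq.congr_deriv (by rw [inner_euclidOp_I_smul (hSherm s ξ), mul_zero])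
    have hc := is_const_of_deriv_eq_zero (fun s => (hd s).differentiableAt)
      (fun s => (hd s).deriv) t 0
    rw [hV0] at hc
    exact (sq_eq_sq₀ (norm_nonneg _) (norm_nonneg _)).1 hc
  · apply (WithLp.ofLp_injective 2)
    change (Complex.I • S t ξ) *ᵥ (V t ξ).ofLp =
      -(2 * Real.pi * ξ * Complex.I) • (hermPart (B t) *ᵥ (V t ξ).ofLp)
        + (Complex.I • skewPart (B t)) *ᵥ (V t ξ).ofLp
    rw [hS, smul_sub, Matrix.sub_mulVec, smul_smul, Matrix.smul_mulVec _ (hermPart (B t)),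
      neg_smul, mul_comm Complex.I]
    abel

section Superposition

variable {n : ℕ} {B : ℝ → Matrix (Fin n) (Fin n) ℂ} {x : EuclideanSpace ℂ (Fin n)}
  {V : ℝ → ℝ → EuclideanSpace ℂ (Fin n)}

/-- The superposition of the plane waves `e^{2πiξp} V(t, ξ)` with density `lorentzian`. -/
noncomputable def superposition (V : ℝ → ℝ → EuclideanSpace ℂ (Fin n)) (t p : ℝ) :
    EuclideanSpace ℂ (Fin n) :=
  ∫ ξ, (planeWave ξ p * lorentzian ξ) • V t ξ

lemma continuous_superposition (cV : Continuous (Function.uncurry V))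
    (hV : ∀ t ξ, ‖V t ξ‖ = ‖x‖) : Continuous (Function.uncurry (superposition V)) := by
  refine continuous_of_dominated (F := fun (z : ℝ × ℝ) ξ =>
      (planeWave ξ z.2 * lorentzian ξ) • V z.1 ξ)
    (bound := fun ξ => ‖lorentzian ξ‖ * ‖x‖) (fun z => ?_) (fun z => ?_)
    (integrable_lorentzian.norm.mul_const _) (Filter.Eventually.of_forall fun ξ => ?_)
  · have h1 : Continuous fun ξ => planeWave ξ z.2 :=
      continuous_planeWave.comp (Continuous.prodMk_left z.2)
    have h2 : Continuous (V z.1) := cV.comp (Continuous.prodMk_right z.1)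
    exact Continuous.aestronglyMeasurable (by fun_prop)
  · exact Filter.Eventually.of_forall fun ξ => by
      simp [norm_smul, norm_planeWave, hV]
  · have h1 : Continuous fun z : ℝ × ℝ => planeWave ξ z.2 :=
      continuous_planeWave.comp (by fun_prop : Continuous fun z : ℝ × ℝ => (ξ, z.2))
    have h2 : Continuous fun z : ℝ × ℝ => V z.1 ξ :=
      cV.comp (by fun_prop : Continuous fun z : ℝ × ℝ => (z.1, ξ))
    fun_prop

lemma superposition_zero (hV0 : ∀ ξ, V 0 ξ = x) (p : ℝ) :
    superposition V 0 p = Real.exp (-|p|) • x := by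
  simp only [superposition, hV0]
  rw [integral_smul_const, integral_planeWave_mul_lorentzian, Complex.coe_smul]

lemma integrable_waveTransform_smul (cV : Continuous (Function.uncurry V))
    (hV : ∀ t ξ, ‖V t ξ‖ = ‖x‖) {φ : ℝ → ℝ} (hφ : Continuous φ) (hφi : Integrable φ) (t : ℝ) :
    Integrable fun ξ => (lorentzian ξ * waveTransform φ ξ) • V t ξ := by
  have h1 : Continuous (waveTransform φ) := continuous_waveTransform hφi hφ
  have h2 : Continuous (V t) := cV.comp (Continuous.prodMk_right t)
  refine ((integrable_lorentzian.norm.mul_const (∫ p, ‖φ p‖)).mul_const ‖x‖).mono'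
    (Continuous.aestronglyMeasurable (by fun_prop)) (Filter.Eventually.of_forall fun ξ => ?_)
  rw [norm_smul, norm_mul, Complex.norm_real, hV]
  gcongr
  exact norm_waveTransform_le φ ξ

lemma integral_smul_superposition (cV : Continuous (Function.uncurry V))
    (hV : ∀ t ξ, ‖V t ξ‖ = ‖x‖) {φ : ℝ → ℝ} (hφ : Continuous φ) (hφi : Integrable φ) (t : ℝ) :
    ∫ p, φ p • superposition V t p = ∫ ξ, (lorentzian ξ * waveTransform φ ξ) • V t ξ := by
  have h2 : Continuous (V t) := cV.comp (Continuous.prodMk_right t)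
  have hint : Integrable (Function.uncurry fun p ξ : ℝ =>
      φ p • ((planeWave ξ p * lorentzian ξ) • V t ξ)) (volume.prod volume) := by
    have h1 : Continuous fun z : ℝ × ℝ => planeWave z.2 z.1 :=
      continuous_planeWave.comp continuous_swap
    refine ((hφi.norm.mul_prod integrable_lorentzian.norm).mul_const ‖x‖).mono'
      (Continuous.aestronglyMeasurable ?_) (Filter.Eventually.of_forall fun z => ?_)
    · simp only [Function.uncurry_def]
      fun_prop
    · simp [Function.uncurry_def, norm_smul, norm_planeWave, hV, mul_assoc]
  calc ∫ p, φ p • superposition V t p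
      = ∫ p, ∫ ξ, φ p • ((planeWave ξ p * lorentzian ξ) • V t ξ) := by
        simp only [superposition, integral_smul]
    _ = ∫ ξ, ∫ p, φ p • ((planeWave ξ p * lorentzian ξ) • V t ξ) := integral_integral_swap hint
    _ = _ := by
        refine integral_congr_ae (Filter.Eventually.of_forall fun ξ => ?_)
        simp only
        rw [waveTransform, ← integral_const_mul, ← integral_smul_const]
        refine integral_congr_ae (Filter.Eventually.of_forall fun p => ?_)
        simp only
        rw [← Complex.coe_smul (φ p), smul_smul]
        congr 1
        ring

/-- The superposition of Fourier modes solves the transport system weakly. The factor `-2πiξ` in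
the equation of the modes is absorbed by the test function, whose transform it turns into that of
the derivative; the differentiated integrand is thus dominated by a multiple of `lorentzian`. -/
lemma hasDerivAt_integral_smul_superposition (cV : Continuous (Function.uncurry V))
    (hV : ∀ t ξ, ‖V t ξ‖ = ‖x‖)
    (hV' : ∀ t ξ, HasDerivAt (fun s => V s ξ)
        (-(2 * Real.pi * ξ * Complex.I) • euclidOp (hermPart (B t)) (V t ξ)
          + euclidOp (Complex.I • skewPart (B t)) (V t ξ)) t)
    {C : ℝ} (hC1 : ∀ t, ‖euclidOp (hermPart (B t))‖ ≤ C)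
    (hC2 : ∀ t, ‖euclidOp (Complex.I • skewPart (B t))‖ ≤ C)
    {φ : ℝ → ℝ} (hφ : ContDiff ℝ 1 φ) (hc : HasCompactSupport φ) (t : ℝ) :
    HasDerivAt (fun s => ∫ p, φ p • superposition V s p)
      (euclidOp (hermPart (B t)) (∫ p, deriv φ p • superposition V t p)
        + euclidOp (Complex.I • skewPart (B t)) (∫ p, φ p • superposition V t p)) t := by
  have c0 : Continuous φ := hφ.continuous
  have c1 : Continuous (deriv φ) := hφ.continuous_deriv le_rfl
  have i0 : Integrable φ := c0.integrable_of_hasCompactSupport hc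
  have i1 : Integrable (deriv φ) := c1.integrable_of_hasCompactSupport hc.deriv
  have j0 := integrable_waveTransform_smul cV hV c0 i0
  have j1 := integrable_waveTransform_smul cV hV c1 i1
  have hC0 : 0 ≤ C := (norm_nonneg _).trans (hC1 0)
  simp only [integral_smul_superposition cV hV c0 i0, integral_smul_superposition cV hV c1 i1]
  rw [← ContinuousLinearMap.integral_comp_comm _ (j1 t),
    ← ContinuousLinearMap.integral_comp_comm _ (j0 t),
    ← integral_add (ContinuousLinearMap.integrable_comp _ (j1 t))
      (ContinuousLinearMap.integrable_comp _ (j0 t))]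
  have hbound : ∀ (L : EuclideanSpace ℂ (Fin n) →L[ℝ] EuclideanSpace ℂ (Fin n)) (ψ : ℝ → ℝ) s ξ,
      ‖L‖ ≤ C → ‖L ((lorentzian ξ * waveTransform ψ ξ) • V s ξ)‖
        ≤ C * (‖lorentzian ξ‖ * (∫ p, ‖ψ p‖) * ‖x‖) := by
    intro L ψ s ξ hL
    refine (L.le_opNorm _).trans ?_
    rw [norm_smul, norm_mul, Complex.norm_real, hV]
    gcongr
    exact norm_waveTransform_le ψ ξ
  refine (hasDerivAt_integral_of_dominated_loc_of_deriv_le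
    (F := fun s ξ => (lorentzian ξ * waveTransform φ ξ) • V s ξ)
    (F' := fun s ξ => euclidOp (hermPart (B s)) ((lorentzian ξ * waveTransform (deriv φ) ξ) • V s ξ)
      + euclidOp (Complex.I • skewPart (B s)) ((lorentzian ξ * waveTransform φ ξ) • V s ξ))
    (bound := fun ξ => C * (‖lorentzian ξ‖ * (∫ p, ‖deriv φ p‖) * ‖x‖)
      + C * (‖lorentzian ξ‖ * (∫ p, ‖φ p‖) * ‖x‖))
    Filter.univ_mem ?_ (j0 t) ?_ ?_ ?_ ?_).2
  · exact Filter.Eventually.of_forall fun s => (j0 s).aestronglyMeasurable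
  · exact ((ContinuousLinearMap.integrable_comp _ (j1 t)).add
      (ContinuousLinearMap.integrable_comp _ (j0 t))).aestronglyMeasurable
  · exact Filter.Eventually.of_forall fun ξ s _ => (norm_add_le _ _).trans
      (add_le_add (hbound _ _ _ _ (hC1 s)) (hbound _ _ _ _ (hC2 s)))
  · exact (((integrable_lorentzian.norm.mul_const _).mul_const _).const_mul _).add
      (((integrable_lorentzian.norm.mul_const _).mul_const _).const_mul _)
  · refine Filter.Eventually.of_forall fun ξ s _ => ?_
    refine ((hV' s ξ).const_smul ((lorentzian ξ : ℂ) * waveTransform φ ξ)).congr_deriv ?_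
    rw [euclidOp_apply_smul, euclidOp_apply_smul, smul_add, smul_smul, waveTransform_deriv hφ hc]
    congr 2
    ring

end Superposition

theorem exists_isTransportSolution {n : ℕ} {T : ℝ} (hT : 0 ≤ T)
    {A : ℝ → Matrix (Fin n) (Fin n) ℂ} (hA : ContinuousOn A (Icc 0 T)) (u₀ : Fin n → ℂ) :
    ∃ w, IsTransportSolution T A u₀ w := by
  set B : ℝ → Matrix (Fin n) (Fin n) ℂ := fun t => A (clampTime T t) with hB
  have cB : Continuous B := hA.comp_continuous (continuous_clampTime T) (clampTime_mem hT)
  obtain ⟨V, cV, hV0, hV, hV'⟩ := exists_fourier_modes cB (WithLp.toLp 2 u₀)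
  obtain ⟨C1, hC1⟩ := (isCompact_Icc (a := (0 : ℝ)) (b := T)).exists_bound_of_continuousOn
    (continuous_euclidOp.comp_continuousOn (continuous_hermPart.comp_continuousOn hA))
  obtain ⟨C2, hC2⟩ := (isCompact_Icc (a := (0 : ℝ)) (b := T)).exists_bound_of_continuousOn
    (continuous_euclidOp.comp_continuousOn
      ((continuous_skewPart.comp_continuousOn hA).const_smul Complex.I))
  have hweak := fun {φ : ℝ → ℝ} => hasDerivAt_integral_smul_superposition (φ := φ) cV hV hV'
    (C := max C1 C2) (fun t => (hC1 _ (clampTime_mem hT t)).trans (le_max_left _ _))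
    (fun t => (hC2 _ (clampTime_mem hT t)).trans (le_max_right _ _))
  let e : EuclideanSpace ℂ (Fin n) ≃L[ℝ] (Fin n → ℂ) :=
    PiLp.continuousLinearEquiv 2 ℝ (fun _ : Fin n => ℂ)
  have hint : ∀ (φ : ℝ → ℝ) t, ∫ p, φ p • e (superposition V t p) =
      e (∫ p, φ p • superposition V t p) := by
    intro φ t
    rw [← e.integral_comp_comm]
    simp only [map_smul]
  refine ⟨fun t p => e (superposition V t p), ?_, ?_, ?_⟩
  · exact (e.continuous.comp (continuous_superposition cV hV)).continuousOn
  · intro p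
    rw [superposition_zero hV0, map_smul]
    rfl
  · intro φ hφ hc t ht
    simp only [hint]
    have h := hweak (hφ.of_le (by simp)) hc t
    simp only [hB, clampTime_of_mem ht] at h
    have h2 := (e.toContinuousLinearMap.hasFDerivAt.comp_hasDerivAt t h).hasDerivWithinAt
      (s := Icc 0 T)
    refine h2.congr_deriv ?_
    rw [← Matrix.smul_mulVec]
    rfl

/-! ### Recovery of the solution of the differential equation -/

/-- If `u' = A u`, then `e^{-p} u(t)` solves the transport system: there `-∂ₚ` acts as the
identity, and `H₁ + i H₂ = A`. -/
lemma IsODESolution.isWeakTransport {n : ℕ} {T : ℝ} {A : ℝ → Matrix (Fin n) (Fin n) ℂ}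
    {u₀ : Fin n → ℂ} {u : ℝ → Fin n → ℂ} (hu : IsODESolution T A u₀ u) :
    IsWeakTransport T A fun t p => Real.exp (-p) • u t where
  continuousOn := by
    have h : ContinuousOn u (Icc 0 T) := fun t ht => (hu.ode t ht).continuousWithinAt
    have h2 : ContinuousOn (fun z : ℝ × ℝ => u z.1) (Icc 0 T ×ˢ univ) :=
      h.comp continuousOn_fst fun z hz => hz.1
    have h3 : Continuous fun z : ℝ × ℝ => Real.exp (-z.2) := by fun_prop
    exact h3.continuousOn.smul h2
  weak φ hφ hc t ht := by
    have key : ∀ (ψ : ℝ → ℝ) s, ∫ p, ψ p • Real.exp (-p) • u s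
        = (∫ p, ψ p * Real.exp (-p)) • u s := by
      intro ψ s
      rw [← integral_smul_const]
      simp only [smul_smul]
    have c0 : Continuous φ := hφ.continuous
    have c1 : Continuous (deriv φ) := hφ.continuous_deriv (by simp)
    have hparts : ∫ p, deriv φ p * Real.exp (-p) = ∫ p, φ p * Real.exp (-p) := by
      have hd : ∀ p : ℝ, HasDerivAt (fun p => Real.exp (-p)) (-Real.exp (-p)) p := fun p => by
        simpa using (hasDerivAt_neg p).exp
      have := integral_mul_deriv_eq_deriv_mul_of_integrable (u := φ)
        (v := fun p => Real.exp (-p)) (u' := deriv φ) (v' := fun p => -Real.exp (-p))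
        (fun p _ => (hφ.differentiable (by simp) p).hasDerivAt) (fun p _ => hd p)
        (Continuous.integrable_of_hasCompactSupport (by fun_prop) hc.mul_right)
        (Continuous.integrable_of_hasCompactSupport (by fun_prop) hc.deriv.mul_right)
        (Continuous.integrable_of_hasCompactSupport (by fun_prop) hc.mul_right)
      simp only [mul_neg, integral_neg, neg_inj] at this
      exact this.symm
    simp only [key, hparts]
    refine ((hu.ode t ht).const_smul (∫ p, φ p * Real.exp (-p))).congr_deriv ?_
    rw [← Matrix.smul_mulVec Complex.I, ← Matrix.add_mulVec, hermPart_add_I_smul_skewPart,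
      Matrix.mulVec_smul]

namespace IsTransportSolution

variable {n : ℕ} {T : ℝ} {A : ℝ → Matrix (Fin n) (Fin n) ℂ} {u₀ : Fin n → ℂ}
  {w w' : ℝ → ℝ → Fin n → ℂ}

theorem unique (hT : 0 ≤ T) (hA : ContinuousOn A (Icc 0 T)) (h : IsTransportSolution T A u₀ w)
    (h' : IsTransportSolution T A u₀ w') {t : ℝ} (ht : t ∈ Icc 0 T) (p : ℝ) :
    w t p = w' t p := by
  have hcH : ContinuousOn (fun t => hermPart (A t)) (Icc 0 T) :=
    continuous_hermPart.comp_continuousOn hA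
  have := (h.isWeakTransport.sub h'.isWeakTransport).eq_zero_of_initial_eq_zero hT hA
    (lambdaMaxPlus_nonneg T fun t => hermPart (A t))
    (fun t ht x => inner_euclidOp_le_lambdaMaxPlus hcH (fun t => hermPart_isHermitian _) ht x)
    (a := p - lambdaMaxPlus T (fun t => hermPart (A t)) * t - 1)
    (fun q _ => by rw [h.initial, h'.initial, sub_self]) t ht p (by linarith)
  exact sub_eq_zero.1 this

/-- Ahead of the fastest characteristic issued from `p = 0`, the solution is `e^{-p} u(t)`. At the
characteristic itself this holds by continuity. -/
theorem eq_exp_smul (hT : 0 ≤ T) (hA : ContinuousOn A (Icc 0 T))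
    (h : IsTransportSolution T A u₀ w) {u : ℝ → Fin n → ℂ} (hu : IsODESolution T A u₀ u)
    {t : ℝ} (ht : t ∈ Icc 0 T) {p : ℝ}
    (hp : lambdaMaxPlus T (fun t => hermPart (A t)) * t ≤ p) :
    w t p = Real.exp (-p) • u t := by
  set lam := lambdaMaxPlus T fun t => hermPart (A t) with hlam
  have hcH : ContinuousOn (fun t => hermPart (A t)) (Icc 0 T) :=
    continuous_hermPart.comp_continuousOn hA
  have hzero := (h.isWeakTransport.sub hu.isWeakTransport).eq_zero_of_initial_eq_zero hT hA
    (lambdaMaxPlus_nonneg _ _)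
    (fun t ht x => inner_euclidOp_le_lambdaMaxPlus hcH (fun t => hermPart_isHermitian _) ht x)
    (a := 0) (fun q hq => by rw [h.initial, hu.initial, abs_of_pos hq, sub_self]) t ht
  have hcont : Continuous fun q : ℝ => Real.exp (-q) • u t := by fun_prop
  have hEq : EqOn (w t) (fun q => Real.exp (-q) • u t) (closure (Ioi (lam * t))) :=
    EqOn.closure (fun q hq => sub_eq_zero.1 (hzero q (by rwa [zero_add])))
      (h.isWeakTransport.continuous_slice ht) hcont
  exact hEq (by rw [closure_Ioi]; exact hp)

end IsTransportSolution

theorem theorem3p1 (n : ℕ) (T : ℝ) (hT : 0 < T)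
    (A : ℝ → Matrix (Fin n) (Fin n) ℂ) (hA : ContinuousOn A (Icc 0 T))
    (u₀ : Fin n → ℂ) :
    -- the transport system has a solution, and only one
    (∃ w, IsTransportSolution T A u₀ w) ∧
    (∀ w w', IsTransportSolution T A u₀ w → IsTransportSolution T A u₀ w' →
      ∀ t ∈ Icc 0 T, ∀ p : ℝ, w t p = w' t p) ∧
    -- recovery of the solution of the ODE, by point evaluation and by integration
    (∀ u w, IsODESolution T A u₀ u → IsTransportSolution T A u₀ w →
      ∀ pd : ℝ, lambdaMaxPlus T (fun t => hermPart (A t)) * T ≤ pd →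
      ∀ p : ℝ, pd ≤ p → ∀ t ∈ Icc 0 T,
        u t = Real.exp p • w t p ∧
        IntegrableOn (w t) (Ioi p) ∧
        u t = Real.exp p • ∫ q in Ioi p, w t q) := by
  refine ⟨exists_isTransportSolution hT.le hA u₀,
    fun w w' hw hw' t ht p => hw.unique hT.le hA hw' ht p, ?_⟩
  intro u w hu hw pd hpd p hp t ht
  have hw_eq : ∀ q, p ≤ q → w t q = Real.exp (-q) • u t := fun q hq =>
    hw.eq_exp_smul hT.le hA hu ht
      ((mul_le_mul_of_nonneg_left ht.2 (lambdaMaxPlus_nonneg _ _)).trans (hpd.trans (hp.trans hq)))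
  have hexp : Real.exp p * Real.exp (-p) = 1 := by
    rw [← Real.exp_add, add_neg_cancel, Real.exp_zero]
  have hEq : EqOn (fun q => Real.exp (-q) • u t) (w t) (Ioi p) :=
    fun q hq => (hw_eq q (le_of_lt hq)).symm
  refine ⟨?_, ?_, ?_⟩
  · rw [hw_eq p le_rfl, smul_smul, hexp, one_smul]
  · exact IntegrableOn.congr_fun ((integrableOn_exp_neg_Ioi p).smul_const (u t)) hEq
      measurableSet_Ioi
  · rw [← setIntegral_congr_fun measurableSet_Ioi hEq, integral_smul_const,
      integral_exp_neg_Ioi, smul_smul, hexp, one_smul]
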